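/- Let $0<\delta\le P$ be real numbers, and let $f_1,f_2,\dots$ be independent random functions on $[-1,1]$ such that, for every $t$, $f_t(x)=Px$ with probability $\frac{1+\delta}{P+1}$ and $f_t(x)=-x$ with probability $\frac{P-\delta}{P+1}$. Let $\alpha_0>0$, $\varepsilon>0$ and $x_0\in[-1,1]$, and let $\beta_1,\beta_2\in(0,1)$ be arbitrary. Consider the ACProp iteration with $m_0=s_0=0$ and, for $t=1,2,\dots$, $$g_t=\nabla f_t(x_{t-1}),\qquad m_t=\beta_1 m_{t-1}+(1-\beta_1)g_t,\qquad \Delta_t=-\frac{\alpha_0}{\sqrt t}\,\frac{g_t}{\sqrt{s_{t-1}}+\varepsilon},$$ $$x_t=\Pi_{[-1,1]}\bigl(x_{t-1}+\Delta_t\bigr),\qquad s_t=\beta_2 s_{t-1}+(1-\beta_2)(g_t-m_t)^2,$$ where $\Pi_{[-1,1]}$ is the projection onto $[-1,1]$. Then: 1. the point $-1$ is the unique minimizer of $x\mapsto\mathbb E[f_t(x)]$ over $[-1,1]$, for every $t$; 2. for every $t\ge 1$, almost surely $$\mathbb E\bigl[\Delta_t \,\big|\, f_1,\dots,f_{t-1}\bigr]\le-\frac{\alpha_0\,\delta}{\sqrt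 t\,(P+1+\varepsilon)};$$ 3. ACProp converges to the optimal solution: $x_t\to-1$ almost surely as $t\to\infty$. -/

import Mathlib

open MeasureTheory ProbabilityTheory Filter Topology

namespace ACProp

/-- State of the optimizer: the iterate `x`, the moving average `m` of the observed gradients,
and the moving average `s` of their squared deviations from `m`. -/
structure State where
  x : ℝ
  m : ℝ
  s : ℝ

/-- The (unprojected) parameter update of one step with learning rate `α` and observed gradient
`g`. The denominator uses the second moment `s` from before `g` is observed. -/
noncomputable def delta (ε α g : ℝ) (z : State) : ℝ :=
  -(α * (g / (√z.s + ε)))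

/-- One step of the algorithm with learning rate `α` on the (differentiable) function `f`, over
the feasible set `[-1, 1]`. The observed gradient is `deriv f z.x`, and the new iterate is
projected onto `[-1, 1]`. -/
noncomputable def step (β₁ β₂ ε α : ℝ) (f : ℝ → ℝ) (z : State) : State where
  x := Set.projIcc (-1 : ℝ) 1 (by norm_num) (z.x + delta ε α (deriv f z.x) z)
  m := β₁ * z.m + (1 - β₁) * deriv f z.x
  s := β₂ * z.s + (1 - β₂) * (deriv f z.x - (β₁ * z.m + (1 - β₁) * deriv f z.x)) ^ 2

/-- The state after `t` steps from `x₀`, `m₀ = 0`, `s₀ = 0`, with learning rate `α₀ / √t` at step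
`t = 1, 2, …`. Step `t + 1` uses the function `f t`. -/
noncomputable def iter (α₀ β₁ β₂ ε x₀ : ℝ) (f : ℕ → ℝ → ℝ) : ℕ → State
  | 0 => ⟨x₀, 0, 0⟩
  | t + 1 => step β₁ β₂ ε (α₀ / √((t : ℝ) + 1)) (f t) (iter α₀ β₁ β₂ ε x₀ f t)

/-- The two possible losses: `P x` (if `b` is true) and `-x` (otherwise). -/
noncomputable def loss (P : ℝ) (b : Bool) (x : ℝ) : ℝ :=
  if b then P * x else -x

/-- The coin flips `ξ` select the losses `f_{t+1} = loss P (ξ t)` of the stochastic problem: they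
are independent, and each of them selects `P x` with probability `(1 + δ) / (P + 1)`. -/
structure IsCoin {Ω : Type*} [MeasurableSpace Ω] (μ : Measure Ω) (P δ : ℝ)
    (ξ : ℕ → Ω → Bool) : Prop where
  measurable : ∀ t, Measurable (ξ t)
  indep : iIndepFun ξ μ
  prob : ∀ t, μ.real {ω | ξ t ω = true} = (1 + δ) / (P + 1)

/-- The σ-algebra generated by the observations of the first `t` steps. -/
abbrev past {Ω : Type*} (ξ : ℕ → Ω → Bool) (t : ℕ) : MeasurableSpace Ω :=
  ⨆ i ∈ Set.Iio t, MeasurableSpace.comap (ξ i) inferInstance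

end ACProp

namespace ACProp

/-! The mean slope is `pP - (1 - p) = δ > 0` for `p = (1 + δ) / (P + 1)`, so the expected loss is `δ
y`. The denominator of an update uses only `s` from before the current gradient, so it is fixed
given the past, and it lies in `[ε, P + 1 + ε]`. Hence the conditional drift points left, which
gives the second claim.

For convergence, rescale to `y_t = √t (x_t + 1)`. The decay of the learning rate cancels, and `y`
behaves like a walk reflected at 0, with bounded steps and drift bounded away from 0 on the negative
side, up to an error tending to 0. For small `θ`, `E exp (θ y_t)` then satisfies an affine recursion
with factor eventually below 1 and stays bounded (`IsCoin.exists_integral_exp_le`). So `E (x_t +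
1)^4 = O(1/t²)`, which is summable, and almost sure convergence follows. -/

/-- The slope of the loss `loss P b`. -/
noncomputable def grad (P : ℝ) (b : Bool) : ℝ := if b then P else -1

theorem deriv_loss (P : ℝ) (b : Bool) (x : ℝ) : deriv (loss P b) x = grad P b := by
  cases b
  · have : loss P false = fun y => -y := by funext y; simp [loss]
    rw [this, deriv_neg]; simp [grad]
  · have : loss P true = fun y => P * y := by funext y; simp [loss]
    rw [this, deriv_const_mul_field, deriv_id'']; simp [grad]

/-! ### Pathwise bounds and the rescaled recursion -/

section Trajectory

variable {P α₀ β₁ β₂ ε x₀ : ℝ}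

theorem iter_x_mem (hx₀ : x₀ ∈ Set.Icc (-1 : ℝ) 1) (f : ℕ → ℝ → ℝ) (t : ℕ) :
    (iter α₀ β₁ β₂ ε x₀ f t).x ∈ Set.Icc (-1 : ℝ) 1 := by
  cases t with
  | zero => exact hx₀
  | succ t => exact Subtype.coe_prop _

theorem iter_m_mem (hP : 0 ≤ P) (hβ₁ : β₁ ∈ Set.Ioo (0 : ℝ) 1) (c : ℕ → Bool) (t : ℕ) :
    (iter α₀ β₁ β₂ ε x₀ (fun i => loss P (c i)) t).m ∈ Set.Icc (-1 : ℝ) P := by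
  induction t with
  | zero => simpa [iter] using hP
  | succ t ih =>
    have hg : grad P (c t) ∈ Set.Icc (-1 : ℝ) P := by
      cases c t <;> simp [grad] <;> linarith
    have := (convex_Icc (-1 : ℝ) P) ih hg hβ₁.1.le (sub_nonneg.2 hβ₁.2.le) (by ring)
    simpa [iter, step, deriv_loss] using this

/-- Gradient and `m` both lie in `[-1, P]`, so each squared deviation is at most `(P + 1)^2`, and
`s` averages these with its initial 0. -/
theorem iter_s_mem (hP : 0 ≤ P) (hβ₁ : β₁ ∈ Set.Ioo (0 : ℝ) 1) (hβ₂ : β₂ ∈ Set.Ioo (0 : ℝ) 1)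
    (c : ℕ → Bool) (t : ℕ) :
    (iter α₀ β₁ β₂ ε x₀ (fun i => loss P (c i)) t).s ∈ Set.Icc (0 : ℝ) ((P + 1) ^ 2) := by
  induction t with
  | zero => simpa [iter] using sq_nonneg (P + 1)
  | succ t ih =>
    have hg : grad P (c t) ∈ Set.Icc (-1 : ℝ) P := by
      cases c t <;> simp [grad] <;> linarith
    have hm : (iter α₀ β₁ β₂ ε x₀ (fun i => loss P (c i)) (t + 1)).m ∈ Set.Icc (-1 : ℝ) P :=
      iter_m_mem hP hβ₁ c (t + 1)
    have hd : (grad P (c t) - (iter α₀ β₁ β₂ ε x₀ (fun i => loss P (c i)) (t + 1)).m) ^ 2 ∈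
        Set.Icc (0 : ℝ) ((P + 1) ^ 2) :=
      ⟨sq_nonneg _, sq_le_sq' (by linarith [hg.1, hm.2]) (by linarith [hg.2, hm.1])⟩
    have := (convex_Icc (0 : ℝ) ((P + 1) ^ 2)) ih hd hβ₂.1.le (sub_nonneg.2 hβ₂.2.le) (by ring)
    simpa [iter, step, deriv_loss] using this

theorem sqrt_iter_s_le (hP : 0 ≤ P) (hβ₁ : β₁ ∈ Set.Ioo (0 : ℝ) 1)
    (hβ₂ : β₂ ∈ Set.Ioo (0 : ℝ) 1) (c : ℕ → Bool) (t : ℕ) :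
    √(iter α₀ β₁ β₂ ε x₀ (fun i => loss P (c i)) t).s ≤ P + 1 :=
  Real.sqrt_le_iff.2 ⟨by linarith, (iter_s_mem hP hβ₁ hβ₂ c t).2⟩

/-- The factor `√(t + 1)` cancels the learning rate. Changing the scale costs at most `2 (√(t + 1) -
√t)` because `x + 1 ≤ 2`. Clipping at `-1` produces the `max 0`; clipping at `1` only lowers the
iterate. -/
theorem iter_succ_x_add_one_le (hx₀ : x₀ ∈ Set.Icc (-1 : ℝ) 1) (c : ℕ → Bool) (t : ℕ) :
    √((t : ℝ) + 1) * ((iter α₀ β₁ β₂ ε x₀ (fun i => loss P (c i)) (t + 1)).x + 1) ≤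
      max 0 (√t * ((iter α₀ β₁ β₂ ε x₀ (fun i => loss P (c i)) t).x + 1) +
        2 * (√((t : ℝ) + 1) - √t) -
        α₀ / (√(iter α₀ β₁ β₂ ε x₀ (fun i => loss P (c i)) t).s + ε) * grad P (c t)) := by
  have hx := iter_x_mem (α₀ := α₀) (β₁ := β₁) (β₂ := β₂) (ε := ε) hx₀ (fun i => loss P (c i)) t
  have hstep : (iter α₀ β₁ β₂ ε x₀ (fun i => loss P (c i)) (t + 1)).x =
      max (-1) (min 1 ((iter α₀ β₁ β₂ ε x₀ (fun i => loss P (c i)) t).x +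
        delta ε (α₀ / √((t : ℝ) + 1)) (grad P (c t))
          (iter α₀ β₁ β₂ ε x₀ (fun i => loss P (c i)) t))) := by
    simp [iter, step, deriv_loss, Set.coe_projIcc]
  rw [hstep]
  generalize iter α₀ β₁ β₂ ε x₀ (fun i => loss P (c i)) t = z at hx ⊢
  have hr : 0 < √((t : ℝ) + 1) := Real.sqrt_pos.2 (by positivity)
  have hmono : √(t : ℝ) ≤ √((t : ℝ) + 1) := Real.sqrt_le_sqrt (by linarith)
  have hd : √((t : ℝ) + 1) * delta ε (α₀ / √((t : ℝ) + 1)) (grad P (c t)) z =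
      -(α₀ / (√z.s + ε) * grad P (c t)) := by
    rw [delta]
    field_simp
  rcases le_total (z.x + delta ε (α₀ / √((t : ℝ) + 1)) (grad P (c t)) z) (-1) with h | h
  · rw [max_eq_left ((min_le_right _ _).trans h)]
    simp
  · refine le_max_of_le_right ?_
    have h1 : max (-1) (min 1 (z.x + delta ε (α₀ / √((t : ℝ) + 1)) (grad P (c t)) z)) ≤
        z.x + delta ε (α₀ / √((t : ℝ) + 1)) (grad P (c t)) z := max_le h (min_le_right _ _)
    have h2 := mul_le_mul_of_nonneg_left h1 hr.le
    have h3 := mul_nonneg (sub_nonneg.2 hmono) (sub_nonneg.2 hx.2)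
    linarith

end Trajectory

/-! ### Adaptedness of the state to the coin flips -/

theorem past_mono {Ω : Type*} {ξ : ℕ → Ω → Bool} : Monotone (past ξ) := fun _ _ hst =>
  biSup_mono fun _ hi => lt_of_lt_of_le hi hst

theorem measurable_past_succ {Ω : Type*} {ξ : ℕ → Ω → Bool} (t : ℕ) :
    Measurable[past ξ (t + 1)] (ξ t) :=
  measurable_iff_comap_le.2 (le_iSup₂_of_le t (Set.mem_Iio.2 t.lt_succ_self) le_rfl)

theorem measurable_iter {Ω : Type*} {P : ℝ} {ξ : ℕ → Ω → Bool} (α₀ β₁ β₂ ε x₀ : ℝ) (t : ℕ) :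
    Measurable[past ξ t] (fun ω => (iter α₀ β₁ β₂ ε x₀ (fun i => loss P (ξ i ω)) t).x) ∧
    Measurable[past ξ t] (fun ω => (iter α₀ β₁ β₂ ε x₀ (fun i => loss P (ξ i ω)) t).m) ∧
    Measurable[past ξ t] (fun ω => (iter α₀ β₁ β₂ ε x₀ (fun i => loss P (ξ i ω)) t).s) := by
  induction t with
  | zero => exact ⟨measurable_const, measurable_const, measurable_const⟩
  | succ t ih =>
    have hle := past_mono (ξ := ξ) t.le_succ
    have hg : Measurable[past ξ (t + 1)] (fun ω => grad P (ξ t ω)) :=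
      (measurable_of_countable (grad P)).comp (measurable_past_succ t)
    obtain ⟨hx, hm, hs⟩ := ih
    replace hx := hx.mono hle le_rfl
    replace hm := hm.mono hle le_rfl
    replace hs := hs.mono hle le_rfl
    have hproj : Measurable fun y : ℝ => (Set.projIcc (-1 : ℝ) 1 (by norm_num) y : ℝ) :=
      (continuous_subtype_val.comp continuous_projIcc).measurable
    simp only [iter, step, deriv_loss, delta]
    refine ⟨hproj.comp (hx.add ?_), ?_, ?_⟩
    · exact ((hg.div (hs.sqrt.add_const ε)).const_mul _).neg
    · exact (hm.const_mul _).add (hg.const_mul _)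
    · exact (hs.const_mul _).add
        (((hg.sub ((hm.const_mul _).add (hg.const_mul _))).pow_const 2).const_mul _)

/-! ### Conditioning on the past of an independent coin -/

section Measurability

variable {Ω : Type*} [MeasurableSpace Ω] {μ : Measure Ω} {P δ : ℝ} {ξ : ℕ → Ω → Bool}

theorem past_le (hξ : ∀ t, Measurable (ξ t)) (t : ℕ) : past ξ t ≤ ‹MeasurableSpace Ω› :=
  iSup₂_le fun i _ => (hξ i).comap_le

theorem IsCoin.indep_past [IsProbabilityMeasure μ] (hξ : IsCoin μ P δ ξ) (t : ℕ) :
    Indep (MeasurableSpace.comap (ξ t) inferInstance) (past ξ t) μ := by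
  have := indep_iSup_of_disjoint (fun i => (hξ.measurable i).comap_le) hξ.indep.iIndep
    (S := {t}) (T := Set.Iio t) (by simp)
  simpa only [iSup_singleton] using this

theorem IsCoin.integral_indicator (hξ : IsCoin μ P δ ξ) (t : ℕ) :
    ∫ ω, (if ξ t ω then (1 : ℝ) else 0) ∂μ = (1 + δ) / (P + 1) := by
  rw [← hξ.prob t, ← integral_indicator_one]
  · congr 1
    funext ω
    simp [Set.indicator_apply]
  · exact hξ.measurable t (measurableSet_singleton true)

theorem IsCoin.integrable_ite [IsProbabilityMeasure μ] (hξ : IsCoin μ P δ ξ) (t : ℕ)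
    {h₁ h₂ : Ω → ℝ} {C : ℝ} (hm₁ : Measurable h₁) (hm₂ : Measurable h₂)
    (hC₁ : ∀ ω, |h₁ ω| ≤ C) (hC₂ : ∀ ω, |h₂ ω| ≤ C) :
    Integrable (fun ω => if ξ t ω then h₁ ω else h₂ ω) μ := by
  refine .of_bound (Measurable.ite (hξ.measurable t (measurableSet_singleton true)) hm₁
    hm₂).aestronglyMeasurable C (.of_forall fun ω => ?_)
  rw [Real.norm_eq_abs]
  split_ifs
  exacts [hC₁ ω, hC₂ ω]

/-- With `I` the indicator of heads, the variable is `h₂ + (h₁ - h₂) I`: past-measurable factors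
pull out, and `I` is independent of the past. -/
theorem IsCoin.condExp_ite [IsProbabilityMeasure μ] (hξ : IsCoin μ P δ ξ) (t : ℕ)
    {h₁ h₂ : Ω → ℝ} {C : ℝ} (hm₁ : Measurable[past ξ t] h₁) (hm₂ : Measurable[past ξ t] h₂)
    (hC₁ : ∀ ω, |h₁ ω| ≤ C) (hC₂ : ∀ ω, |h₂ ω| ≤ C) :
    μ[fun ω => if ξ t ω then h₁ ω else h₂ ω | past ξ t] =ᵐ[μ]
      fun ω => (1 + δ) / (P + 1) * h₁ ω + (1 - (1 + δ) / (P + 1)) * h₂ ω := by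
  have hle := past_le hξ.measurable t
  set I : Ω → ℝ := fun ω => if ξ t ω then 1 else 0 with hI
  have hIm : StronglyMeasurable[MeasurableSpace.comap (ξ t) inferInstance] I :=
    ((measurable_of_countable fun b : Bool => if b then (1 : ℝ) else 0).comp
      (comap_measurable (ξ t))).stronglyMeasurable
  have hIint : Integrable I μ :=
    hξ.integrable_ite t (C := 1) measurable_const measurable_const (by simp) (by simp)
  have hint₂ : Integrable h₂ μ :=
    .of_bound (hm₂.mono hle le_rfl).aestronglyMeasurable C (.of_forall hC₂)
  have hbd : ∀ ω, ‖(h₁ - h₂) ω‖ ≤ C + C := fun ω =>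
    (abs_sub _ _).trans (add_le_add (hC₁ ω) (hC₂ ω))
  have hdec : (fun ω => if ξ t ω then h₁ ω else h₂ ω) = h₂ + (h₁ - h₂) * I := by
    funext ω
    by_cases h : ξ t ω <;> simp [hI, h]
  have hprod : Integrable ((h₁ - h₂) * I) μ :=
    hIint.bdd_mul ((hm₁.sub hm₂).mono hle le_rfl).aestronglyMeasurable (.of_forall hbd)
  rw [hdec]
  have e1 := condExp_stronglyMeasurable_mul_of_bound hle (hm₁.sub hm₂).stronglyMeasurable hIint
    (C + C) (.of_forall hbd)
  have e2 := condExp_indep_eq (hξ.measurable t).comap_le hle hIm (hξ.indep_past t)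
  have e3 := condExp_of_stronglyMeasurable hle hm₂.stronglyMeasurable hint₂
  filter_upwards [condExp_add hint₂ hprod (past ξ t), e1, e2] with ω a1 a2 a3
  rw [a1, Pi.add_apply, a2, e3, Pi.mul_apply, a3, hξ.integral_indicator t, Pi.sub_apply]
  ring

theorem IsCoin.integral_ite [IsProbabilityMeasure μ] (hξ : IsCoin μ P δ ξ) (t : ℕ)
    {h₁ h₂ : Ω → ℝ} {C : ℝ} (hm₁ : Measurable[past ξ t] h₁) (hm₂ : Measurable[past ξ t] h₂)
    (hC₁ : ∀ ω, |h₁ ω| ≤ C) (hC₂ : ∀ ω, |h₂ ω| ≤ C) :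
    ∫ ω, (if ξ t ω then h₁ ω else h₂ ω) ∂μ =
      ∫ ω, ((1 + δ) / (P + 1) * h₁ ω + (1 - (1 + δ) / (P + 1)) * h₂ ω) ∂μ := by
  rw [← integral_condExp (past_le hξ.measurable t)]
  exact integral_congr_ae (hξ.condExp_ite t hm₁ hm₂ hC₁ hC₂)

theorem IsCoin.integral_loss [IsProbabilityMeasure μ] (hP : 0 < P) (hξ : IsCoin μ P δ ξ)
    (t : ℕ) (y : ℝ) : ∫ ω, loss P (ξ t ω) y ∂μ = δ * y := by
  have := hξ.integral_ite t (h₁ := fun _ => P * y) (h₂ := fun _ => -y) (C := max |P * y| |-y|)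
    measurable_const measurable_const (fun _ => le_max_left _ _) (fun _ => le_max_right _ _)
  simp only [loss]
  rw [this]
  simp only [integral_const, probReal_univ, one_smul]
  field_simp
  ring

end Measurability

/-! ### Contraction and summability estimates -/

section Contraction

/-- A bounded random variable with positive mean has Laplace transform uniformly below one, on
compact sets of small positive parameters. -/
theorem exists_laplace_contraction {P δ p b₀ b₁ : ℝ} (hP : 0 < P) (hδ : 0 < δ) (hp₀ : 0 ≤ p)
    (hp₁ : p ≤ 1) (hmean : p * P - (1 - p) = δ) (hb₀ : 0 < b₀) (hb : b₀ ≤ b₁) :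
    ∃ θ > 0, ∃ κ > 0, ∀ b ∈ Set.Icc b₀ b₁,
      p * Real.exp (-(θ * b * P)) + (1 - p) * Real.exp (θ * b) ≤ 1 - κ := by
  have hb₁ : 0 < b₁ := hb₀.trans_le hb
  have hQ : 0 < P ^ 2 + 1 := by positivity
  -- For `u = θ b`, the bound 1 on `u (P² + 1)` validates `exp v ≤ 1 + v + v²` at `v = u` and `v =
  -- -uP`; the bound `δ / 2` lets the quadratic error absorb only half of the gain `u δ`.
  set θ : ℝ := min 1 (δ / 2) / (b₁ * (P ^ 2 + 1)) with hθ
  have hθ0 : 0 < θ := div_pos (lt_min one_pos (half_pos hδ)) (by positivity)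
  have hθe : θ * b₁ * (P ^ 2 + 1) = min 1 (δ / 2) := by rw [hθ]; field_simp
  refine ⟨θ, hθ0, θ * b₀ * (δ / 2), by positivity, fun b hbm => ?_⟩
  have hbpos : 0 < b := hb₀.trans_le hbm.1
  set u : ℝ := θ * b with hu
  have hu0 : 0 < u := mul_pos hθ0 hbpos
  have hub : u ≤ θ * b₁ := mul_le_mul_of_nonneg_left hbm.2 hθ0.le
  have hul : θ * b₀ ≤ u := mul_le_mul_of_nonneg_left hbm.1 hθ0.le
  have huQ : u * (P ^ 2 + 1) ≤ min 1 (δ / 2) :=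
    (mul_le_mul_of_nonneg_right hub hQ.le).trans hθe.le
  have hu1 : u * (P ^ 2 + 1) ≤ 1 := huQ.trans (min_le_left _ _)
  have hu2 : u * (P ^ 2 + 1) ≤ δ / 2 := huQ.trans (min_le_right _ _)
  have hPQ : P ≤ P ^ 2 + 1 := by nlinarith [sq_nonneg (P - 1)]
  have huP : u * P ≤ 1 := (mul_le_mul_of_nonneg_left hPQ hu0.le).trans hu1
  have hule : u ≤ 1 := by nlinarith [mul_nonneg hu0.le (sq_nonneg P)]
  have h1 : Real.exp (-(u * P)) ≤ 1 - u * P + (u * P) ^ 2 := by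
    have := (abs_le.1 (Real.abs_exp_sub_one_sub_id_le (x := -(u * P))
      (by rw [abs_neg, abs_of_pos (by positivity)]; exact huP))).2
    linarith [neg_sq (u * P)]
  have h2 : Real.exp u ≤ 1 + u + u ^ 2 := by
    have := (abs_le.1 (Real.abs_exp_sub_one_sub_id_le (x := u)
      (by rw [abs_of_pos hu0]; exact hule))).2
    linarith
  have hq : 0 ≤ 1 - p := by linarith
  have h3 := mul_le_mul_of_nonneg_left h1 hp₀
  have h4 := mul_le_mul_of_nonneg_left h2 hq
  have h5 : p * (1 - u * P + (u * P) ^ 2) + (1 - p) * (1 + u + u ^ 2) ≤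
      1 - u * δ + u * (u * (P ^ 2 + 1)) := by
    have e1 : p * (u * P) ^ 2 ≤ (u * P) ^ 2 := mul_le_of_le_one_left (sq_nonneg _) hp₁
    have e2 : (1 - p) * u ^ 2 ≤ u ^ 2 := mul_le_of_le_one_left (sq_nonneg _) (by linarith)
    rw [← hmean]
    linarith
  have h6 := mul_le_mul_of_nonneg_left hu2 hu0.le
  have h7 := mul_le_mul_of_nonneg_right hul (half_pos hδ).le
  linarith

/-- `1 / (1 - q)` is the fixed point of `v ↦ 1 + q v`, so any bound above it persists once `r t ≤
q`. -/
theorem eventually_bounded_of_le_one_add_mul {u r : ℕ → ℝ} {q : ℝ} (hu : ∀ t, 0 ≤ u t)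
    (hq₀ : 0 ≤ q) (hq : q < 1) (hr : ∀ᶠ t in atTop, r t ≤ q) (hrec : ∀ t, u (t + 1) ≤ 1 + r t * u t) :
    ∃ K, ∀ᶠ t in atTop, u t ≤ K := by
  obtain ⟨N, hN⟩ := eventually_atTop.1 hr
  refine ⟨max (u N) (1 / (1 - q)), eventually_atTop.2 ⟨N, fun t ht => ?_⟩⟩
  induction t, ht using Nat.le_induction with
  | base => exact le_max_left _ _
  | succ t ht ih =>
    set K := max (u N) (1 / (1 - q))
    have hK : 1 ≤ K * (1 - q) := (div_le_iff₀ (by linarith)).1 (le_max_right _ _)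
    have h1 := mul_le_mul_of_nonneg_right (hN t ht) (hu t)
    have h2 := mul_le_mul_of_nonneg_left ih hq₀
    linarith [hrec t]

theorem tendsto_sqrt_succ_sub_sqrt :
    Tendsto (fun t : ℕ => √((t : ℝ) + 1) - √t) atTop (𝓝 0) := by
  have hlim : Tendsto (fun t : ℕ => 1 / √((t : ℝ) + 1)) atTop (𝓝 0) := by
    refine tendsto_const_nhds.div_atTop (Real.tendsto_sqrt_atTop.comp ?_)
    exact tendsto_atTop_add_const_right _ _ tendsto_natCast_atTop_atTop
  refine squeeze_zero (fun t => sub_nonneg.2 (Real.sqrt_le_sqrt (by linarith)))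
    (fun t => ?_) hlim
  have ht : (0 : ℝ) ≤ t := t.cast_nonneg
  have hr : 0 < √((t : ℝ) + 1) := Real.sqrt_pos.2 (by positivity)
  have hmono : √(t : ℝ) ≤ √((t : ℝ) + 1) := Real.sqrt_le_sqrt (by linarith)
  rw [le_div_iff₀ hr]
  nlinarith [Real.mul_self_sqrt ht, Real.mul_self_sqrt (add_nonneg ht zero_le_one),
    Real.sqrt_nonneg (t : ℝ)]

/-- Nonnegative random variables with summable expectations tend to zero almost surely. -/
theorem ae_tendsto_zero_of_integral_le {Ω : Type*} [MeasurableSpace Ω] {μ : Measure Ω}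
    {Y : ℕ → Ω → ℝ} {a : ℕ → ℝ} (hY : ∀ t ω, 0 ≤ Y t ω) (hint : ∀ t, Integrable (Y t) μ)
    (hle : ∀ᶠ t in atTop, ∫ ω, Y t ω ∂μ ≤ a t) (ha : Summable a) :
    ∀ᵐ ω ∂μ, Tendsto (fun t => Y t ω) atTop (𝓝 0) := by
  have hnn : ∀ t, 0 ≤ ∫ ω, Y t ω ∂μ := fun t => integral_nonneg (hY t)
  have hsum : Summable fun t => ∫ ω, Y t ω ∂μ := by
    refine ha.of_norm_bounded_eventually_nat ?_
    filter_upwards [hle] with t ht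
    rwa [Real.norm_of_nonneg (hnn t)]
  have hmeas : ∀ t, AEMeasurable (fun ω => ENNReal.ofReal (Y t ω)) μ := fun t =>
    (hint t).aemeasurable.ennreal_ofReal
  have hfin : ∫⁻ ω, ∑' t, ENNReal.ofReal (Y t ω) ∂μ ≠ ⊤ := by
    rw [lintegral_tsum hmeas]
    simp_rw [← ofReal_integral_eq_lintegral_ofReal (hint _) (.of_forall (hY _))]
    rw [← ENNReal.ofReal_tsum_of_nonneg hnn hsum]
    exact ENNReal.ofReal_ne_top
  filter_upwards [ae_lt_top' (AEMeasurable.tsum hmeas) hfin] with ω hω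
  have h := ENNReal.tendsto_atTop_zero_of_tsum_ne_top hω.ne
  have h' := (ENNReal.tendsto_toReal ENNReal.zero_ne_top).comp h
  simpa [Function.comp_def, ENNReal.toReal_ofReal (hY _ _)] using h'

end Contraction

/-! ### Drift, exponential moments and convergence -/

section Main

variable {Ω : Type*} [MeasurableSpace Ω] {μ : Measure Ω} [IsProbabilityMeasure μ]
  {P δ : ℝ} {ξ : ℕ → Ω → Bool} {α₀ β₁ β₂ ε x₀ : ℝ}

theorem IsCoin.condExp_delta_le (hδ : 0 < δ) (hδP : δ ≤ P) (hξ : IsCoin μ P δ ξ) (hα₀ : 0 < α₀)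
    (hβ₁ : β₁ ∈ Set.Ioo (0 : ℝ) 1) (hβ₂ : β₂ ∈ Set.Ioo (0 : ℝ) 1) (hε : 0 < ε) (t : ℕ) :
    ∀ᵐ ω ∂μ, (μ[fun ω' =>
        delta ε (α₀ / √((t : ℝ) + 1)) (grad P (ξ t ω'))
          (iter α₀ β₁ β₂ ε x₀ (fun i => loss P (ξ i ω')) t) | past ξ t]) ω ≤
      -(α₀ * δ) / (√((t : ℝ) + 1) * (P + 1 + ε)) := by
  have hP : 0 < P := hδ.trans_le hδP
  have hr : 0 < √((t : ℝ) + 1) := Real.sqrt_pos.2 (by positivity)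
  set D : Ω → ℝ := fun ω => √(iter α₀ β₁ β₂ ε x₀ (fun i => loss P (ξ i ω)) t).s + ε with hD
  have hDm : Measurable[past ξ t] D := (measurable_iter α₀ β₁ β₂ ε x₀ t).2.2.sqrt.add_const ε
  have hDε : ∀ ω, ε ≤ D ω := fun ω => by simp [hD]
  have hDle : ∀ ω, D ω ≤ P + 1 + ε := fun ω =>
    add_le_add_left (sqrt_iter_s_le hP.le hβ₁ hβ₂ (fun i => ξ i ω) t) ε
  set α : ℝ := α₀ / √((t : ℝ) + 1) with hα
  have hαpos : 0 < α := div_pos hα₀ hr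
  have hfun : (fun ω' => delta ε α (grad P (ξ t ω'))
      (iter α₀ β₁ β₂ ε x₀ (fun i => loss P (ξ i ω')) t)) =
      fun ω' => if ξ t ω' then -(α * (P / D ω')) else -(α * (-1 / D ω')) := by
    funext ω'
    by_cases h : ξ t ω' <;> simp [delta, grad, h, hD]
  have hbound : ∀ (g : ℝ) (ω : Ω), |-(α * (g / D ω))| ≤ α * (|g| / ε) := fun g ω => by
    rw [abs_neg, abs_mul, abs_of_pos hαpos, abs_div, abs_of_pos (hε.trans_le (hDε ω))]
    gcongr
    exact hDε ω
  rw [hfun]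
  filter_upwards [hξ.condExp_ite t (h₁ := fun ω => -(α * (P / D ω)))
    (h₂ := fun ω => -(α * (-1 / D ω))) (C := max (α * (|P| / ε)) (α * (|(-1 : ℝ)| / ε)))
    ((measurable_const.div hDm).const_mul α).neg ((measurable_const.div hDm).const_mul α).neg
    (fun ω => (hbound P ω).trans (le_max_left _ _))
    (fun ω => (hbound (-1) ω).trans (le_max_right _ _))] with ω hω
  rw [hω]
  have hDpos : 0 < D ω := hε.trans_le (hDε ω)
  calc (1 + δ) / (P + 1) * -(α * (P / D ω)) + (1 - (1 + δ) / (P + 1)) * -(α * (-1 / D ω))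
      = -(α₀ * δ / (√((t : ℝ) + 1) * D ω)) := by rw [hα]; field_simp; ring
    -- The drift is weakest when the denominator is largest.
    _ ≤ -(α₀ * δ / (√((t : ℝ) + 1) * (P + 1 + ε))) := by
      refine neg_le_neg ?_
      gcongr
      exact hDle ω
    _ = -(α₀ * δ) / (√((t : ℝ) + 1) * (P + 1 + ε)) := by rw [neg_div]

/-- The exponential moments of the distance to the minimizer, rescaled by `√t`, stay bounded. -/
theorem IsCoin.exists_integral_exp_le (hδ : 0 < δ) (hδP : δ ≤ P) (hξ : IsCoin μ P δ ξ)
    (hα₀ : 0 < α₀) (hβ₁ : β₁ ∈ Set.Ioo (0 : ℝ) 1) (hβ₂ : β₂ ∈ Set.Ioo (0 : ℝ) 1) (hε : 0 < ε)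
    (hx₀ : x₀ ∈ Set.Icc (-1 : ℝ) 1) :
    ∃ θ > 0, ∃ K, ∀ᶠ t : ℕ in atTop, ∫ ω, Real.exp (θ * (√(t : ℝ) *
      ((iter α₀ β₁ β₂ ε x₀ (fun i => loss P (ξ i ω)) t).x + 1))) ∂μ ≤ K := by
  have hP : 0 < P := hδ.trans_le hδP
  have hp₀ : 0 ≤ (1 + δ) / (P + 1) := by positivity
  have hp₁ : (1 + δ) / (P + 1) ≤ 1 := (div_le_one (by positivity)).2 (by linarith)
  obtain ⟨θ, hθ, κ, hκ, hcon⟩ := exists_laplace_contraction (p := (1 + δ) / (P + 1))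
    (b₀ := α₀ / (P + 1 + ε)) (b₁ := α₀ / ε) hP hδ hp₀ hp₁ (by field_simp; ring) (by positivity)
    (by gcongr; linarith)
  refine ⟨θ, hθ, ?_⟩
  set x : ℕ → Ω → ℝ := fun t ω => (iter α₀ β₁ β₂ ε x₀ (fun i => loss P (ξ i ω)) t).x with hx
  set b : ℕ → Ω → ℝ := fun t ω =>
    α₀ / (√(iter α₀ β₁ β₂ ε x₀ (fun i => loss P (ξ i ω)) t).s + ε) with hb
  set V : ℕ → Ω → ℝ := fun t ω => Real.exp (θ * (√(t : ℝ) * (x t ω + 1))) with hV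
  have hxm : ∀ t, Measurable[past ξ t] (x t) := fun t => (measurable_iter α₀ β₁ β₂ ε x₀ t).1
  have hbm : ∀ t, Measurable[past ξ t] (b t) := fun t =>
    measurable_const.div ((measurable_iter α₀ β₁ β₂ ε x₀ t).2.2.sqrt.add_const ε)
  have hVm : ∀ t, Measurable[past ξ t] (V t) := fun t =>
    ((((hxm t).add_const 1).const_mul _).const_mul _).exp
  have hxmem : ∀ t ω, x t ω ∈ Set.Icc (-1 : ℝ) 1 := fun t ω => iter_x_mem hx₀ _ t
  have hbmem : ∀ t ω, b t ω ∈ Set.Icc (α₀ / (P + 1 + ε)) (α₀ / ε) := fun t ω => by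
    have h := sqrt_iter_s_le (α₀ := α₀) (ε := ε) (x₀ := x₀) hP.le hβ₁ hβ₂ (fun i => ξ i ω) t
    constructor
    · simp only [hb]
      gcongr
    · simp only [hb]
      gcongr
      linarith [Real.sqrt_nonneg (iter α₀ β₁ β₂ ε x₀ (fun i => loss P (ξ i ω)) t).s]
  have hVle : ∀ t ω, V t ω ≤ Real.exp (θ * (√(t : ℝ) * 2)) := fun t ω => by
    simp only [hV]
    gcongr
    linarith [(hxmem t ω).2]
  have hVint : ∀ t, Integrable (V t) μ := fun t =>
    .of_bound ((hVm t).mono (past_le hξ.measurable t) le_rfl).aestronglyMeasurable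
      (Real.exp (θ * (√(t : ℝ) * 2))) (.of_forall fun ω => by
        rw [Real.norm_of_nonneg (Real.exp_pos _).le]; exact hVle t ω)
  -- `R t → 1` is the cost of rescaling; `A g t` is the exponential moment variable after a step of
  -- slope `g`, without that cost and without reflection.
  set R : ℕ → ℝ := fun t => Real.exp (θ * (2 * (√((t : ℝ) + 1) - √t))) with hR
  set A : ℝ → ℕ → Ω → ℝ := fun g t ω => V t ω * Real.exp (-(θ * b t ω * g)) with hA
  have hAm : ∀ g t, Measurable[past ξ t] (A g t) := fun g t =>
    (hVm t).mul (((hbm t).const_mul θ).mul_const g).neg.exp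
  have hAle : ∀ g t ω, |A g t ω| ≤
      Real.exp (θ * (√(t : ℝ) * 2)) * Real.exp (θ * (α₀ / ε) * |g|) := fun g t ω => by
    rw [abs_of_pos (mul_pos (Real.exp_pos _) (Real.exp_pos _))]
    have hb0 : 0 ≤ b t ω := le_trans (by positivity) (hbmem t ω).1
    refine mul_le_mul (hVle t ω) (Real.exp_le_exp.2 ?_) (Real.exp_pos _).le (Real.exp_pos _).le
    calc -(θ * b t ω * g) = θ * b t ω * -g := by ring
      _ ≤ θ * b t ω * |g| := by gcongr; exact neg_le_abs g
      _ ≤ θ * (α₀ / ε) * |g| := by gcongr; exact (hbmem t ω).2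
  have hpath : ∀ t ω, V (t + 1) ω ≤ 1 + R t * (if ξ t ω then A P t ω else A (-1) t ω) := by
    intro t ω
    have hgrad : (if ξ t ω then A P t ω else A (-1) t ω) = A (grad P (ξ t ω)) t ω := by
      by_cases h : ξ t ω <;> simp [h, grad]
    have h := iter_succ_x_add_one_le (P := P) (α₀ := α₀) (β₁ := β₁) (β₂ := β₂) (ε := ε) hx₀
      (fun i => ξ i ω) t
    rw [hgrad]
    calc V (t + 1) ω ≤ Real.exp (θ * max 0 (√t * (x t ω + 1) +
          2 * (√((t : ℝ) + 1) - √t) - b t ω * grad P (ξ t ω))) := by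
          simp only [hV, Nat.cast_add, Nat.cast_one]
          exact Real.exp_le_exp.2 (mul_le_mul_of_nonneg_left h hθ.le)
      -- Reflection at 0 costs only an additive 1.
      _ ≤ 1 + Real.exp (θ * (√t * (x t ω + 1) +
          2 * (√((t : ℝ) + 1) - √t) - b t ω * grad P (ξ t ω))) := by
          rcases max_choice 0 (√t * (x t ω + 1) +
            2 * (√((t : ℝ) + 1) - √t) - b t ω * grad P (ξ t ω)) with h' | h' <;> rw [h']
          · rw [mul_zero, Real.exp_zero]
            linarith [Real.exp_pos (θ * (√t * (x t ω + 1) +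
              2 * (√((t : ℝ) + 1) - √t) - b t ω * grad P (ξ t ω)))]
          · linarith
      _ = 1 + R t * A (grad P (ξ t ω)) t ω := by
          simp only [hR, hA, hV]
          rw [← Real.exp_add, ← Real.exp_add]
          ring_nf
  have hite : ∀ t, Integrable (fun ω => if ξ t ω then A P t ω else A (-1) t ω) μ := fun t =>
    hξ.integrable_ite t ((hAm P t).mono (past_le hξ.measurable t) le_rfl)
      ((hAm (-1) t).mono (past_le hξ.measurable t) le_rfl)
      (fun ω => (hAle P t ω).trans (le_max_left _ _))
      (fun ω => (hAle (-1) t ω).trans (le_max_right _ _))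
  have hone : ∀ t, ∫ ω, (if ξ t ω then A P t ω else A (-1) t ω) ∂μ ≤
      (1 - κ) * ∫ ω, V t ω ∂μ := fun t => by
    rw [hξ.integral_ite t (hAm P t) (hAm (-1) t)
      (fun ω => (hAle P t ω).trans (le_max_left _ _))
      (fun ω => (hAle (-1) t ω).trans (le_max_right _ _)), ← integral_const_mul]
    refine integral_mono_of_nonneg (.of_forall fun ω => ?_) ((hVint t).const_mul _)
      (.of_forall fun ω => ?_)
    · have h1 : 0 ≤ 1 - (1 + δ) / (P + 1) := by linarith
      simp only [hA, hV, Pi.zero_apply]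
      positivity
    · have h := mul_le_mul_of_nonneg_left (hcon (b t ω) (hbmem t ω)) (Real.exp_pos
        (θ * (√(t : ℝ) * (x t ω + 1)))).le
      simp only [hA]
      calc _ = V t ω * ((1 + δ) / (P + 1) * Real.exp (-(θ * b t ω * P)) +
            (1 - (1 + δ) / (P + 1)) * Real.exp (θ * b t ω)) := by
            rw [mul_neg_one, neg_neg]; ring
        _ ≤ V t ω * (1 - κ) := h
        _ = _ := mul_comm _ _
  have hrec : ∀ t, ∫ ω, V (t + 1) ω ∂μ ≤ 1 + R t * (1 - κ) * ∫ ω, V t ω ∂μ := fun t => by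
    calc ∫ ω, V (t + 1) ω ∂μ
        ≤ ∫ ω, (1 + R t * (if ξ t ω then A P t ω else A (-1) t ω)) ∂μ :=
          integral_mono (hVint _) ((integrable_const _).add ((hite t).const_mul _)) (hpath t)
      _ = 1 + R t * ∫ ω, (if ξ t ω then A P t ω else A (-1) t ω) ∂μ := by
          rw [integral_add (integrable_const _) ((hite t).const_mul _), integral_const_mul]
          simp
      _ ≤ 1 + R t * ((1 - κ) * ∫ ω, V t ω ∂μ) := by
          gcongr
          exact hone t
      _ = _ := by ring
  have hRlim : Tendsto (fun t => R t * (1 - κ)) atTop (𝓝 (1 - κ)) := by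
    have h := ((tendsto_sqrt_succ_sub_sqrt.const_mul 2).const_mul θ).rexp.mul_const (1 - κ)
    simpa using h
  -- Half of `κ` is given up to absorb `R t`; the `max 0` supplies `0 ≤ q`.
  exact eventually_bounded_of_le_one_add_mul
    (fun t => integral_nonneg fun ω => (Real.exp_pos _).le) (q := max 0 (1 - κ / 2))
    (le_max_left _ _) (max_lt one_pos (by linarith))
    (hRlim.eventually_le_const (lt_max_of_lt_right (by linarith))) hrec

theorem IsCoin.ae_tendsto_iter (hδ : 0 < δ) (hδP : δ ≤ P) (hξ : IsCoin μ P δ ξ)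
    (hα₀ : 0 < α₀) (hβ₁ : β₁ ∈ Set.Ioo (0 : ℝ) 1) (hβ₂ : β₂ ∈ Set.Ioo (0 : ℝ) 1) (hε : 0 < ε)
    (hx₀ : x₀ ∈ Set.Icc (-1 : ℝ) 1) :
    ∀ᵐ ω ∂μ, Tendsto (fun t : ℕ => (iter α₀ β₁ β₂ ε x₀ (fun i => loss P (ξ i ω)) t).x)
      atTop (𝓝 (-1)) := by
  obtain ⟨θ, hθ, K, hK⟩ := hξ.exists_integral_exp_le hδ hδP hα₀ hβ₁ hβ₂ hε hx₀
  set x : ℕ → Ω → ℝ := fun t ω => (iter α₀ β₁ β₂ ε x₀ (fun i => loss P (ξ i ω)) t).x with hx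
  have hxmem : ∀ t ω, x t ω ∈ Set.Icc (-1 : ℝ) 1 := fun t ω => iter_x_mem hx₀ _ t
  have hxm : ∀ t, Measurable (x t) := fun t =>
    (measurable_iter α₀ β₁ β₂ ε x₀ t).1.mono (past_le hξ.measurable t) le_rfl
  have hint : ∀ t, Integrable (fun ω => (x t ω + 1) ^ 4) μ := fun t =>
    .of_bound (((hxm t).add_const 1).pow_const 4).aestronglyMeasurable (2 ^ 4)
      (.of_forall fun ω => by
        have h0 : 0 ≤ x t ω + 1 := by linarith [(hxmem t ω).1]
        rw [Real.norm_of_nonneg (by positivity)]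
        gcongr
        linarith [(hxmem t ω).2])
  have hexp : ∀ t : ℕ, Integrable (fun ω => Real.exp (θ * (√(t : ℝ) * (x t ω + 1)))) μ := fun t =>
    .of_bound ((((hxm t).add_const 1).const_mul _).const_mul _).exp.aestronglyMeasurable
      (Real.exp (θ * (√(t : ℝ) * 2))) (.of_forall fun ω => by
        rw [Real.norm_of_nonneg (Real.exp_pos _).le]
        gcongr
        linarith [(hxmem t ω).2])
  -- The fourth moment, from `z^4 / 4! ≤ exp z`, decays like `1 / t²`; the second would give only
  -- the non-summable `1 / t`.
  have hle : ∀ᶠ t : ℕ in atTop, ∫ ω, (x t ω + 1) ^ 4 ∂μ ≤ 24 * K / θ ^ 4 * (1 / (t : ℝ) ^ 2) := by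
    filter_upwards [hK, eventually_gt_atTop 0] with t ht ht0
    have ht0' : (0 : ℝ) < t := Nat.cast_pos.2 ht0
    have hpt : ∀ ω, (x t ω + 1) ^ 4 ≤ 24 / (θ ^ 4 * (t : ℝ) ^ 2) *
        Real.exp (θ * (√(t : ℝ) * (x t ω + 1))) := fun ω => by
      have h0 : 0 ≤ x t ω + 1 := by linarith [(hxmem t ω).1]
      have h := Real.pow_div_factorial_le_exp (θ * (√(t : ℝ) * (x t ω + 1))) (by positivity) 4
      have hs : √(t : ℝ) ^ 4 = (t : ℝ) ^ 2 := by
        rw [show (4 : ℕ) = 2 * 2 from rfl, pow_mul, Real.sq_sqrt ht0'.le]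
      rw [mul_pow, mul_pow, hs, show ((Nat.factorial 4 : ℕ) : ℝ) = 24 by norm_num [Nat.factorial],
        div_le_iff₀ (by norm_num)] at h
      rw [div_mul_eq_mul_div, le_div_iff₀ (by positivity)]
      linarith
    calc ∫ ω, (x t ω + 1) ^ 4 ∂μ
        ≤ ∫ ω, 24 / (θ ^ 4 * (t : ℝ) ^ 2) * Real.exp (θ * (√(t : ℝ) * (x t ω + 1))) ∂μ :=
          integral_mono (hint t) ((hexp t).const_mul _) hpt
      _ = 24 / (θ ^ 4 * (t : ℝ) ^ 2) * ∫ ω, Real.exp (θ * (√(t : ℝ) * (x t ω + 1))) ∂μ :=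
          integral_const_mul _ _
      _ ≤ 24 / (θ ^ 4 * (t : ℝ) ^ 2) * K := by gcongr
      _ = _ := by field_simp
  have hsum : Summable fun t : ℕ => 24 * K / θ ^ 4 * (1 / (t : ℝ) ^ 2) :=
    (Real.summable_one_div_nat_pow.2 one_lt_two).mul_left _
  filter_upwards [ae_tendsto_zero_of_integral_le (fun t ω => by positivity) hint hle hsum]
    with ω hω
  have h4 : Tendsto (fun t => x t ω + 1) atTop (𝓝 0) := by
    have h := hω.sqrt.sqrt
    simp only [Real.sqrt_zero] at h
    refine h.congr fun t => ?_
    have h0 : 0 ≤ x t ω + 1 := by linarith [(hxmem t ω).1]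
    rw [show (x t ω + 1) ^ 4 = ((x t ω + 1) ^ 2) ^ 2 by ring, Real.sqrt_sq (sq_nonneg _),
      Real.sqrt_sq h0]
  simpa using h4.sub_const 1

end Main

end ACProp

theorem mainTheorem4 {Ω : Type*} [MeasurableSpace Ω] (μ : Measure Ω) [IsProbabilityMeasure μ]
    (P δ : ℝ) (hδ : 0 < δ) (hδP : δ ≤ P)
    (ξ : ℕ → Ω → Bool) (hξ : ACProp.IsCoin μ P δ ξ)
    (α₀ β₁ β₂ ε x₀ : ℝ) (hα₀ : 0 < α₀) (hβ₁ : β₁ ∈ Set.Ioo (0 : ℝ) 1)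
    (hβ₂ : β₂ ∈ Set.Ioo (0 : ℝ) 1) (hε : 0 < ε) (hx₀ : x₀ ∈ Set.Icc (-1 : ℝ) 1) :
    -- the point `-1` is the unique minimizer of the expected loss over `[-1, 1]`
    (∀ t : ℕ, ∀ y ∈ Set.Icc (-1 : ℝ) 1, y ≠ -1 →
      ∫ ω, ACProp.loss P (ξ t ω) (-1) ∂μ < ∫ ω, ACProp.loss P (ξ t ω) y ∂μ) ∧
    -- the conditional expectation of the update at step `t + 1`, given the first `t` steps
    (∀ t : ℕ, ∀ᵐ ω ∂μ,
      (μ[fun ω' =>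
          let z := ACProp.iter α₀ β₁ β₂ ε x₀ (fun i => ACProp.loss P (ξ i ω')) t
          ACProp.delta ε (α₀ / √((t : ℝ) + 1)) (deriv (ACProp.loss P (ξ t ω')) z.x) z
        | ACProp.past ξ t]) ω ≤ -(α₀ * δ) / (√((t : ℝ) + 1) * (P + 1 + ε))) ∧
    -- almost sure convergence of the iterates to the minimizer
    (∀ᵐ ω ∂μ, Tendsto
      (fun t : ℕ => (ACProp.iter α₀ β₁ β₂ ε x₀ (fun i => ACProp.loss P (ξ i ω)) t).x)
      atTop (𝓝 (-1))) := by
  have hP : 0 < P := hδ.trans_le hδP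
  refine ⟨fun t y hy hne => ?_, fun t => ?_,
    hξ.ae_tendsto_iter hδ hδP hα₀ hβ₁ hβ₂ hε hx₀⟩
  · rw [hξ.integral_loss hP, hξ.integral_loss hP]
    exact mul_lt_mul_of_pos_left (lt_of_le_of_ne hy.1 hne.symm) hδ
  · simp only [ACProp.deriv_loss]
    exact hξ.condExp_delta_le hδ hδP hα₀ hβ₁ hβ₂ hε t
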